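/- Let $\Omega=(0,L)^3$, and for $a\in\mathbb R$ let $\mathbb X_a$ be the set of $u\in H^1(\Omega)^3$ that are $L$-periodic in $x$ and $y$ and satisfy $u=(0,0,0)$ on $z=0$ and $u=(a,0,0)$ on $z=L$ (in the sense of traces). Let $S^h\subset W^{1,3}(\Omega)^3$ and $Q^h\subset L^2_0(\Omega)=\{q\in L^2(\Omega):\int_\Omega q\,dx=0\}$ be finite-dimensional (finite element) spaces; put $\mathbb X^h=S^h\cap\mathbb X_U$, $\mathbb X^h_0=S^h\cap\mathbb X_0$, and assume that $\mathbb X^h$ contains the linears, that is, all affine vector fields belonging to $\mathbb X_U$. Write $(\cdot,\cdot)$ for the $L^2(\Omega)$ inner product, $(\nabla u)_{ij}=\partial u_j/\partial x_i$, $|\nabla u|$ for the Frobenius norm and $b(u,v,w)=\frac12(u\cdot\nabla v,w)-\frac12(u\cdot\nabla w,v)$. There is an absolute constant $C>0$ such that the following holds for all $L,U,\nu,C_s,\delta>0$, with $\mathcal Re=UL/\nu$, all mesh sizes $0<h<L$, all such $S^h,Q^h$ and all $u_0\in L^2(\Omega)^3$. Let $u^h:[0,\infty)\to\mathbb X^h$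 be continuous, and differentiable for $t>0$, and let $p^h:(0,\infty)\to Q^h$, such that for all $t>0$ $$(u^h_t,v^h)+\nu(\nabla u^h,\nabla v^h)+b(u^h,u^h,v^h)-(p^h,\nabla\cdot v^h)+\big((C_s\delta)^2|\nabla u^h|\nabla u^h,\nabla v^h\big)=0\quad\forall v^h\in\mathbb X_0^h,$$ $$(\nabla\cdot u^h,q^h)=0\quad\forall q^h\in Q^h,$$ and $(u^h(0)-u_0,v^h)=0$ for all $v^h\in\mathbb X^h_0$ with $(\nabla\cdot v^h,q^h)=0$ for all $q^h\in Q^h$. Then the computed dissipation rate $$\varepsilon(u^h)(t)=\frac1{L^3}\int_\Omega\Big(\nu|\nabla u^h|^2+(C_s\delta)^2|\nabla u^h|^3\Big)dx$$ is integrable on $(0,T)$ for every $T>0$, and its time average $\langle\varepsilon(u^h)\rangle=\limsup_{T\to\infty}\frac1T\int_0^T\varepsilon(u^h)(t)\,dt$ satisfies $$\langle\varepsilon(u^h)\rangle\le C\left[\frac1{\mathcal Re}\frac Lh+\Big(\frac{C_s\delta}{h}\Big)^2+\frac{L^5}{(C_s\delta)^4h}+\frac{L^{5/2}h^{3/2}}{(C_s\delta)^4}\right]\frac{U^3}{L}.$$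 -/

import Mathlib

open MeasureTheory Filter Set
open scoped ContDiff

noncomputable section

namespace Smagorinsky

/-- Points of `ℝ³`, with coordinates `x = x 0`, `y = x 1`, `z = x 2`. Every Euclidean norm used
below is written out in coordinates. -/
abbrev Pt : Type := Fin 3 → ℝ

/-- A velocity field together with its gradient tensor; `f.2 x i j` stands for `∂ f_j / ∂ x_i`. -/
abbrev VField : Type := (Pt → Pt) × (Pt → Fin 3 → Fin 3 → ℝ)

/-- The flow domain `Ω = (0, L)³`. -/
def Omega (L : ℝ) : Set Pt := {x | ∀ i, 0 < x i ∧ x i < L}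

/-- The classical partial derivative `∂ψ/∂x_i`, for scalar test functions. -/
def partialD (ψ : Pt → ℝ) (i : Fin 3) (x : Pt) : ℝ := fderiv ℝ ψ x (Pi.single i 1)

/-- `f.1 ∈ W^{1,p}(Ω)³`, with weak gradient `f.2`. -/
structure MemSobolev (L : ℝ) (p : ENNReal) (f : VField) : Prop where
  val_memLp : ∀ j, MemLp (fun x => f.1 x j) p (volume.restrict (Omega L))
  grad_memLp : ∀ i j, MemLp (fun x => f.2 x i j) p (volume.restrict (Omega L))
  weak_grad : ∀ ψ : Pt → ℝ, ContDiff ℝ ∞ ψ → HasCompactSupport ψ → tsupport ψ ⊆ Omega L →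
    ∀ i j, ∫ x in Omega L, f.1 x j * partialD ψ i x = - ∫ x in Omega L, f.2 x i j * ψ x

/-- The shear boundary conditions with wall velocity `a`, in the sense of traces:
`f = 0` on `z = 0`, `f = (a, 0, 0)` on `z = L`, and `f` is `L`-periodic in `x` and `y`.
By Green's formula `∫_Ω (u_j ∂_iψ + ∂_i u_j ψ) = ∫_{∂Ω} u_j ψ n_i`, an `H¹` field has exactly these
traces if and only if, for all smooth `ψ` that are `L`-periodic in `x` and `y`, the boundary integral
is `a ∫∫ ψ(x, y, L) dx dy` for `(i, j) = (z, x)` and zero for all other `(i, j)`. -/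
def HasShearTraces (L a : ℝ) (f : VField) : Prop :=
  ∀ ψ : Pt → ℝ, ContDiff ℝ ∞ ψ →
    (∀ x, ψ (x + Pi.single 0 L) = ψ x) → (∀ x, ψ (x + Pi.single 1 L) = ψ x) →
    ∀ i j, ∫ x in Omega L, (f.1 x j * partialD ψ i x + f.2 x i j * ψ x) =
      if i = 2 ∧ j = 0 then a * ∫ x in (0 : ℝ)..L, ∫ y in (0 : ℝ)..L, ψ ![x, y, L] else 0

/-- The velocity space `𝕏(Ω)` for wall velocity `a`: `H¹` fields satisfying the shear boundary
conditions. The space `𝕏₀(Ω)` is the case `a = 0`. -/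
structure MemX (L a : ℝ) (f : VField) : Prop where
  memH1 : MemSobolev L 2 f
  traces : HasShearTraces L a f

/-- The pressure space `L²₀(Ω)`. -/
structure MemQ (L : ℝ) (q : Pt → ℝ) : Prop where
  memLp : MemLp q 2 (volume.restrict (Omega L))
  mean_zero : ∫ x in Omega L, q x = 0

/-- The linear (affine) velocity field `x ↦ c + xᵀ B`, whose gradient tensor is `B`. -/
def affineField (c : Pt) (B : Fin 3 → Fin 3 → ℝ) : VField :=
  (fun x j => c j + ∑ i, x i * B i j, fun _ => B)

/-- The `L²` inner product of vector fields on `Ω`. -/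
def ip (L : ℝ) (u v : Pt → Pt) : ℝ := ∫ x in Omega L, ∑ j, u x j * v x j

/-- The `L²` inner product `(∇u, ∇v)`. -/
def gradIp (L : ℝ) (u v : VField) : ℝ := ∫ x in Omega L, ∑ i, ∑ j, u.2 x i j * v.2 x i j

/-- The pointwise (Frobenius) norm `|∇u|`. -/
def gradNorm (u : VField) (x : Pt) : ℝ := Real.sqrt (∑ i, ∑ j, u.2 x i j ^ 2)

/-- The Smagorinsky form `(|∇u| ∇u, ∇v)`. -/
def smagForm (L : ℝ) (u v : VField) : ℝ :=
  ∫ x in Omega L, ∑ i, ∑ j, gradNorm u x * u.2 x i j * v.2 x i j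

/-- `(u · ∇v, w)`. -/
def convect (L : ℝ) (u v w : VField) : ℝ :=
  ∫ x in Omega L, ∑ j, (∑ i, u.1 x i * v.2 x i j) * w.1 x j

/-- The trilinear form `b(u,v,w) = ½ (u · ∇v, w) - ½ (u · ∇w, v)`. -/
def trilin (L : ℝ) (u v w : VField) : ℝ := 1 / 2 * convect L u v w - 1 / 2 * convect L u w v

/-- `(q, ∇ · v)`. -/
def divForm (L : ℝ) (q : Pt → ℝ) (v : VField) : ℝ := ∫ x in Omega L, q x * ∑ i, v.2 x i i

/-- Finite element spaces for the shear flow problem with wall velocity `U`. `S` is the velocity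
finite element space before boundary conditions are imposed, so that the trial space is
`X^h = S ∩ 𝕏` and the test space is `X₀^h = S ∩ 𝕏₀`; `Q` is the discrete pressure space.
The trial space contains the linears. -/
structure IsFEPair (L U : ℝ) (S : Submodule ℝ VField) (Q : Submodule ℝ (Pt → ℝ)) : Prop where
  finDim_velocity : FiniteDimensional ℝ S
  finDim_pressure : FiniteDimensional ℝ Q
  conforming : ∀ v ∈ S, MemSobolev L 3 v
  pressure_mem : ∀ q ∈ Q, MemQ L q
  contains_linears : ∀ c B, MemX L U (affineField c B) → affineField c B ∈ S

/-- The semi-discrete (continuous in time) finite element Smagorinsky problem on `[0, ∞)`, with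
initial datum `u₀`: `u` is the velocity, `ut` its time derivative and `p` the pressure.
Derivative and continuity in time are taken in the finite-dimensional space `S`, that is, through
its linear functionals. The initial condition is tested with the discretely divergence-free
functions only, which is weaker than testing it with all of `X₀^h` and can be met for all `u₀`. -/
structure IsSemiDiscreteSolution (L U ν Cs δ : ℝ) (S : Submodule ℝ VField)
    (Q : Submodule ℝ (Pt → ℝ)) (u₀ : Pt → Pt)
    (u ut : ℝ → S) (p : ℝ → Q) : Prop where
  mem_X : ∀ t, 0 ≤ t → MemX L U (u t)
  continuous_time : ∀ l : Module.Dual ℝ S, ContinuousOn (fun t => l (u t)) (Ici 0)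
  hasDeriv_time : ∀ l : Module.Dual ℝ S, ∀ t, 0 < t →
    HasDerivAt (fun s => l (u s)) (l (ut t)) t
  momentum : ∀ t, 0 < t → ∀ v ∈ S, MemX L 0 v →
    ip L (ut t : VField).1 v.1 + ν * gradIp L (u t) v + trilin L (u t) (u t) v
      - divForm L (p t : Pt → ℝ) v + (Cs * δ) ^ 2 * smagForm L (u t) v = 0
  continuity_eq : ∀ t, 0 < t → ∀ q ∈ Q, divForm L q (u t) = 0
  initial : ∀ v ∈ S, MemX L 0 v → (∀ q ∈ Q, divForm L q v = 0) →
    ip L (fun x => (u 0 : VField).1 x - u₀ x) v.1 = 0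

/-- The energy dissipation rate per unit volume,
`|Ω|⁻¹ ∫_Ω ν |∇u|² + (C_s δ)² |∇u|³ dx`, of the field `u` at one time. -/
def dissipation (L ν Cs δ : ℝ) (u : VField) : ℝ :=
  1 / L ^ 3 * ∫ x in Omega L, (ν * gradNorm u x ^ 2 + (Cs * δ) ^ 2 * gradNorm u x ^ 3)

/-- The time average `⟨ψ⟩ = limsup_{T → ∞} (1/T) ∫₀ᵀ ψ(t) dt`, as an extended real number. -/
def timeAverage (ψ : ℝ → ℝ) : EReal :=
  limsup (fun T : ℝ => ((1 / T * ∫ t in (0 : ℝ)..T, ψ t : ℝ) : EReal)) atTop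

/-- The Reynolds number. -/
def reynolds (U L ν : ℝ) : ℝ := U * L / ν

end Smagorinsky

end

namespace Smagorinsky

/-! ### The box and the divergence theorem -/

/-! Let φ be the Couette field, β = U/L and κ = (C_s δ)². The trial space contains the linears, so v
= u − φ is an admissible test function. The pressure term drops because φ is divergence-free, and
what remains is an identity for d/dt ½‖v‖². In the skew-symmetrized convection the part b(u,v,v)
cancels and b(u,φ,v) is left. It is at most of order β(‖v‖² + L²‖∇v‖²), apart from a term whose
integral vanishes by periodicity.

The Poincaré inequality turns ‖v‖² into L²‖∇v‖², so convection costs O(UL)(|∇u|² + β²) in the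
integrand. This is quadratic in ∇u while the Smagorinsky dissipation κ|∇u|³ is cubic, so Young's
inequality absorbs it at the price of (UL)³/κ². Half of the dissipation survives
(`pointwise_energy_bound`, `energy_lower_bound`). Integrating in time bounds ∫₀ᵀ ε by a constant
plus 2T times `dissipationBound`, and the constant disappears in the time average.

The resulting bound does not depend on the mesh; h enters only through L/h ≥ 1 in
`dissipationBound_le`.

Since boundary values are encoded weakly by integration against smooth periodic functions,
`poincare` is proved by duality: a test function g is written as ∂ψ/∂z with ψ an admissible periodic
function, and density of test functions gives the norm bound. -/

lemma Omega_eq_pi (L : ℝ) : Omega L = Set.pi univ fun _ : Fin 3 => Ioo (0 : ℝ) L := by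
  ext x; simp [Omega]

lemma isOpen_Omega (L : ℝ) : IsOpen (Omega L) := by
  rw [Omega_eq_pi]
  exact isOpen_set_pi finite_univ fun _ _ => isOpen_Ioo

lemma measurableSet_Omega (L : ℝ) : MeasurableSet (Omega L) := (isOpen_Omega L).measurableSet

lemma Omega_ae_eq_Icc (L : ℝ) :
    Omega L =ᵐ[volume] Icc (fun _ : Fin 3 => (0 : ℝ)) (fun _ => L) := by
  rw [Omega_eq_pi]
  exact Measure.univ_pi_Ioo_ae_eq_Icc

lemma Omega_subset_Icc (L : ℝ) : Omega L ⊆ Icc (fun _ : Fin 3 => (0 : ℝ)) (fun _ => L) :=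
  fun _ hx => ⟨fun i => (hx i).1.le, fun i => (hx i).2.le⟩

lemma volume_real_Omega {L : ℝ} (hL : 0 < L) : volume.real (Omega L) = L ^ 3 := by
  rw [Omega_eq_pi, Measure.real, Real.volume_pi_Ioo_toReal (fun _ => hL.le)]
  simp

instance isFiniteMeasure_Omega (L : ℝ) : IsFiniteMeasure (volume.restrict (Omega L)) := by
  refine ⟨?_⟩
  rw [Measure.restrict_apply_univ, measure_congr (Omega_ae_eq_Icc L)]
  exact isCompact_Icc.measure_lt_top

lemma integrableOn_Omega_of_continuous {F : Pt → ℝ} (L : ℝ) (hF : Continuous F) :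
    IntegrableOn F (Omega L) :=
  (hF.continuousOn.integrableOn_compact isCompact_Icc).mono_set (Omega_subset_Icc L)

lemma memLp_of_continuous {F : Pt → ℝ} (L : ℝ) (p : ENNReal) (hF : Continuous F) :
    MemLp F p (volume.restrict (Omega L)) := by
  obtain ⟨M, hM⟩ := (isCompact_Icc (a := fun _ : Fin 3 => (0 : ℝ))
    (b := fun _ => L)).exists_bound_of_continuousOn hF.continuousOn
  refine MemLp.of_bound hF.aestronglyMeasurable M ?_
  filter_upwards [ae_restrict_mem (measurableSet_Omega L)] with x hx
  exact hM x (Omega_subset_Icc L hx)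

lemma continuous_partialD {ψ : Pt → ℝ} (hψ : ContDiff ℝ ∞ ψ) (i : Fin 3) :
    Continuous (partialD ψ i) :=
  (hψ.continuous_fderiv (by simp)).clm_apply continuous_const

lemma partialD_mul {f g : Pt → ℝ} {x : Pt} (hf : DifferentiableAt ℝ f x)
    (hg : DifferentiableAt ℝ g x) (i : Fin 3) :
    partialD (fun y => f y * g y) i x = f x * partialD g i x + partialD f i x * g x := by
  simp only [partialD]
  rw [fderiv_fun_mul hf hg]
  simp [mul_comm]

lemma partialD_coord (k i : Fin 3) (x : Pt) :
    partialD (fun y => y k) i x = if i = k then 1 else 0 := by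
  simp only [partialD]
  have h : fderiv ℝ (fun y : Pt => y k) x = ContinuousLinearMap.proj k :=
    (ContinuousLinearMap.proj (R := ℝ) (φ := fun _ : Fin 3 => ℝ) k).hasFDerivAt.fderiv
  rw [h]
  simp [Pi.single_apply, eq_comm]

/-- The divergence theorem for the field whose only nonzero component is the `i`-th, equal to `F`.
-/
lemma integral_partialD {L : ℝ} (hL : 0 < L) {F : Pt → ℝ} (hF : ContDiff ℝ ∞ F) (i : Fin 3) :
    ∫ x in Omega L, partialD F i x =
      (∫ y in Icc (fun _ : Fin 2 => (0 : ℝ)) (fun _ => L), F (i.insertNth L y)) -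
        ∫ y in Icc (fun _ : Fin 2 => (0 : ℝ)) (fun _ => L), F (i.insertNth 0 y) := by
  rw [setIntegral_congr_set (Omega_ae_eq_Icc L)]
  have key := integral_divergence_of_hasFDerivAt_off_countable' (n := 2)
    (fun _ => (0 : ℝ)) (fun _ => L) (fun _ => hL.le)
    (fun k x => if k = i then F x else 0) (fun k x => if k = i then fderiv ℝ F x else 0) ∅
    countable_empty ?_ ?_ ?_
  · have e : ∀ x, ∑ k, (if k = i then fderiv ℝ F x else 0) (Pi.single k 1) = partialD F i x := by
      intro x
      rw [Finset.sum_eq_single i]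
      · simp [partialD]
      · intro b _ hb; simp [hb]
      · simp
    simp only [e] at key
    rw [key, Finset.sum_eq_single i]
    · simp only [if_true]; rfl
    · intro b _ hb; simp [hb]
    · simp
  · intro k
    by_cases h : k = i
    · simpa [h] using hF.continuous.continuousOn
    · simpa [h] using continuousOn_const
  · intro x _ k
    by_cases h : k = i
    · simpa [h] using (hF.differentiable (by simp) x).hasFDerivAt
    · simpa [h] using hasFDerivAt_const (0 : ℝ) x
  · refine Continuous.integrableOn_Icc ?_
    refine continuous_finsetSum _ fun k _ => ?_
    by_cases h : k = i
    · simpa [h] using (hF.continuous_fderiv (by simp)).clm_apply continuous_const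
    · simpa [h] using continuous_const

lemma integral_face_top {L : ℝ} (hL : 0 < L) {ψ : Pt → ℝ} (hψ : Continuous ψ) :
    ∫ y in Icc (fun _ : Fin 2 => (0 : ℝ)) (fun _ => L), ψ ((2 : Fin 3).insertNth L y) =
      ∫ x in (0 : ℝ)..L, ∫ y in (0 : ℝ)..L, ψ ![x, y, L] := by
  have e : ∀ y : Fin 2 → ℝ, (2 : Fin 3).insertNth (α := fun _ => ℝ) L y = ![y 0, y 1, L] := by
    intro y
    ext k
    fin_cases k
    · exact Fin.insertNth_apply_succAbove (2 : Fin 3) (α := fun _ => ℝ) L y 0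
    · exact Fin.insertNth_apply_succAbove (2 : Fin 3) (α := fun _ => ℝ) L y 1
    · exact Fin.insertNth_apply_same (2 : Fin 3) (α := fun _ => ℝ) L y
  simp only [e]
  have hpre : Icc (fun _ : Fin 2 => (0 : ℝ)) (fun _ => L) =
      (MeasurableEquiv.finTwoArrow (α := ℝ)) ⁻¹' (Icc 0 L ×ˢ Icc 0 L) := by
    ext y
    simp [Pi.le_def, Fin.forall_fin_two, MeasurableEquiv.finTwoArrow]
  have hmp := (volume_preserving_finTwoArrow ℝ).setIntegral_preimage_emb
    (MeasurableEquiv.measurableEmbedding _) (fun q : ℝ × ℝ => ψ ![q.1, q.2, L])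
    (Icc 0 L ×ˢ Icc 0 L)
  rw [hpre]
  refine Eq.trans hmp ?_
  have hc : Continuous fun q : ℝ × ℝ => ψ ![q.1, q.2, L] := by
    refine hψ.comp (continuous_pi fun k => ?_)
    fin_cases k
    · exact continuous_fst
    · exact continuous_snd
    · exact continuous_const
  rw [Measure.volume_eq_prod, setIntegral_prod _
    (by rw [← Measure.volume_eq_prod]
        exact hc.continuousOn.integrableOn_compact (isCompact_Icc.prod isCompact_Icc))]
  simp only [intervalIntegral.integral_of_le hL.le, integral_Icc_eq_integral_Ioc]

/-! ### The Couette field -/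

/-- The Couette flow `(U z / L, 0, 0)`, the only affine field in `𝕏_U`. -/
noncomputable def couette (L U : ℝ) : VField :=
  affineField 0 fun i j => if i = 2 ∧ j = 0 then U / L else 0

lemma couette_val (L U : ℝ) (x : Pt) (j : Fin 3) :
    (couette L U).1 x j = if j = 0 then U / L * x 2 else 0 := by
  fin_cases j <;> simp [couette, affineField, Fin.sum_univ_three, mul_comm]

lemma couette_grad (L U : ℝ) (x : Pt) (i j : Fin 3) :
    (couette L U).2 x i j = if i = 2 ∧ j = 0 then U / L else 0 := rfl

lemma contDiff_couette_val (L U : ℝ) (j : Fin 3) :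
    ContDiff ℝ ∞ fun x => (couette L U).1 x j := by
  simp only [couette_val]
  by_cases h : j = 0
  · simp only [h, if_true]; fun_prop
  · simp only [h, if_false]; fun_prop

lemma partialD_couette (L U : ℝ) (x : Pt) (i j : Fin 3) :
    partialD (fun y => (couette L U).1 y j) i x = (couette L U).2 x i j := by
  simp only [couette_val, couette_grad]
  by_cases h : j = 0
  · simp only [h, if_true, and_true]
    rw [partialD_mul (by fun_prop) (by fun_prop), partialD_coord]
    by_cases hi : i = 2 <;> simp [hi, partialD]
  · simp [h, partialD]

lemma integral_couette_parts {L : ℝ} (hL : 0 < L) (U : ℝ) {ψ : Pt → ℝ} (hψ : ContDiff ℝ ∞ ψ)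
    (i j : Fin 3) :
    ∫ x in Omega L, ((couette L U).1 x j * partialD ψ i x + (couette L U).2 x i j * ψ x) =
      (∫ y in Icc (fun _ : Fin 2 => (0 : ℝ)) (fun _ => L),
          (couette L U).1 (i.insertNth L y) j * ψ (i.insertNth L y)) -
        ∫ y in Icc (fun _ : Fin 2 => (0 : ℝ)) (fun _ => L),
          (couette L U).1 (i.insertNth 0 y) j * ψ (i.insertNth 0 y) := by
  rw [← integral_partialD hL ((contDiff_couette_val L U j).mul hψ) i]
  congr 1 with x
  rw [partialD_mul ((contDiff_couette_val L U j).differentiable (by simp) x)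
    (hψ.differentiable (by simp) x), partialD_couette]

lemma memSobolev_couette {L : ℝ} (hL : 0 < L) (U : ℝ) (p : ENNReal) :
    MemSobolev L p (couette L U) where
  val_memLp j := memLp_of_continuous L p (contDiff_couette_val L U j).continuous
  grad_memLp i j := memLp_of_continuous L p continuous_const
  weak_grad ψ hψ _ hsupp i j := by
    have h := integral_couette_parts hL U hψ i j
    have hz : ∀ x : Pt, x ∉ Omega L → ψ x = 0 := fun x hx =>
      image_eq_zero_of_notMem_tsupport fun h => hx (hsupp h)
    have h1 : ∀ y : Fin 2 → ℝ, ψ (i.insertNth L y) = 0 := fun y => hz _ fun h => by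
      simpa using (h i).2
    have h0 : ∀ y : Fin 2 → ℝ, ψ (i.insertNth 0 y) = 0 := fun y => hz _ fun h => by
      simpa using (h i).1
    simp only [h1, h0, mul_zero, integral_zero, sub_zero] at h
    rw [integral_add] at h
    · linarith
    · exact integrableOn_Omega_of_continuous L
        ((contDiff_couette_val L U j).continuous.mul (continuous_partialD hψ i))
    · exact integrableOn_Omega_of_continuous L (continuous_const.mul hψ.continuous)

lemma hasShearTraces_couette {L : ℝ} (hL : 0 < L) (U : ℝ) :
    HasShearTraces L U (couette L U) := by
  intro ψ hψ h0 h1 i j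
  rw [integral_couette_parts hL U hψ i j]
  by_cases hi : i = 2
  · subst hi
    by_cases hj : j = 0
    · subst hj
      simp only [couette_val, if_true, Fin.insertNth_apply_same, and_self, mul_zero, zero_mul,
        integral_zero, sub_zero]
      rw [integral_const_mul, integral_face_top hL hψ.continuous]
      field_simp
    · simp [couette_val, hj]
  -- On the lateral faces the Couette field depends on z alone and `ψ` is periodic, so opposite
  -- faces cancel.
  · have hper : ∀ x, ψ (x + Pi.single i L) = ψ x := by
      fin_cases i
      · exact h0
      · exact h1
      · exact absurd rfl hi
    have hins : ∀ y : Fin 2 → ℝ, (i.insertNth L y : Pt) = i.insertNth 0 y + Pi.single i L := by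
      intro y
      ext k
      rcases Fin.eq_self_or_eq_succAbove i k with rfl | ⟨k', rfl⟩ <;> simp
    have hval : ∀ y : Fin 2 → ℝ, (couette L U).1 (i.insertNth L y) j =
        (couette L U).1 (i.insertNth 0 y) j := by
      intro y
      rw [hins y, couette_val, couette_val]
      simp [Ne.symm hi]
    simp only [hval]
    simp [hins, hper, hi]

lemma memX_couette {L : ℝ} (hL : 0 < L) (U : ℝ) : MemX L U (couette L U) :=
  ⟨memSobolev_couette hL U 2, hasShearTraces_couette hL U⟩

/-! ### Differences of Sobolev fields and of their traces -/

lemma integrable_mul_of_continuous {L : ℝ} {p : ENNReal} (hp : 1 ≤ p) {a b : Pt → ℝ}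
    (ha : MemLp a p (volume.restrict (Omega L))) (hb : Continuous b) :
    Integrable (fun x => a x * b x) (volume.restrict (Omega L)) :=
  (ha.integrable hp).mul_of_top_left (memLp_of_continuous L ⊤ hb)

lemma MemSobolev.sub {L : ℝ} {p : ENNReal} (hp : 1 ≤ p) {f g : VField} (hf : MemSobolev L p f)
    (hg : MemSobolev L p g) : MemSobolev L p (f - g) where
  val_memLp j := (hf.val_memLp j).sub (hg.val_memLp j)
  grad_memLp i j := (hf.grad_memLp i j).sub (hg.grad_memLp i j)
  weak_grad ψ hψ hc hs i j := by
    have e1 : ∀ x, (f - g).1 x j * partialD ψ i x =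
      f.1 x j * partialD ψ i x - g.1 x j * partialD ψ i x := fun x => by
        simp [sub_mul]
    have e2 : ∀ x, (f - g).2 x i j * ψ x = f.2 x i j * ψ x - g.2 x i j * ψ x := fun x => by
        simp [sub_mul]
    simp only [e1, e2]
    rw [integral_sub (integrable_mul_of_continuous hp (hf.val_memLp j) (continuous_partialD hψ i))
      (integrable_mul_of_continuous hp (hg.val_memLp j) (continuous_partialD hψ i)),
      integral_sub (integrable_mul_of_continuous hp (hf.grad_memLp i j) hψ.continuous)
      (integrable_mul_of_continuous hp (hg.grad_memLp i j) hψ.continuous), hf.weak_grad ψ hψ hc hs i j,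
      hg.weak_grad ψ hψ hc hs i j]
    ring

lemma MemX.sub {L a b : ℝ} {f g : VField} (hf : MemX L a f) (hg : MemX L b g) :
    MemX L (a - b) (f - g) where
  memH1 := hf.memH1.sub (by norm_num) hg.memH1
  traces ψ hψ h0 h1 i j := by
    have hi : ∀ {c : ℝ} {k : VField}, MemX L c k → Integrable (fun x => k.1 x j * partialD ψ i x +
        k.2 x i j * ψ x) (volume.restrict (Omega L)) := fun hk =>
      (integrable_mul_of_continuous (by norm_num) (hk.memH1.val_memLp j)
        (continuous_partialD hψ i)).add
      (integrable_mul_of_continuous (by norm_num) (hk.memH1.grad_memLp i j) hψ.continuous)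
    have e : ∀ x, (f - g).1 x j * partialD ψ i x + (f - g).2 x i j * ψ x =
        (f.1 x j * partialD ψ i x + f.2 x i j * ψ x) -
          (g.1 x j * partialD ψ i x + g.2 x i j * ψ x) := fun x => by
      simp only [Prod.fst_sub, Prod.snd_sub, Pi.sub_apply]; ring
    simp only [e]
    rw [integral_sub (hi hf) (hi hg), hf.traces ψ hψ h0 h1, hg.traces ψ hψ h0 h1]
    split_ifs <;> ring

/-! ### Periodization -/

/-- The `L`-periodic extension in direction `i` of the restriction of `g` to `0 ≤ x i < L`. -/
noncomputable def periodize (L : ℝ) (i : Fin 3) (g : Pt → ℝ) (x : Pt) : ℝ :=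
  g (x - Pi.single i (⌊x i / L⌋ * L))

lemma periodize_add_single {L : ℝ} (hL : 0 < L) (i : Fin 3) (g : Pt → ℝ) (x : Pt) :
    periodize L i g (x + Pi.single i L) = periodize L i g x := by
  unfold periodize
  congr 1
  have : (x + Pi.single i L : Pt) i / L = x i / L + 1 := by
    simp; field_simp
  rw [this, Int.floor_add_one]
  ext k
  by_cases h : k = i
  · subst h; simp; ring
  · simp [h]

lemma periodize_add_single_of_ne {L : ℝ} {i k : Fin 3} (hik : k ≠ i) {g : Pt → ℝ}
    (hg : ∀ x, g (x + Pi.single k L) = g x) (x : Pt) :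
    periodize L i g (x + Pi.single k L) = periodize L i g x := by
  unfold periodize
  rw [← hg (x - _)]
  congr 1
  simp [Ne.symm hik]
  abel

lemma periodize_eq_self {L : ℝ} {i : Fin 3} {g : Pt → ℝ} {x : Pt} (h0 : 0 < x i)
    (h1 : x i < L) : periodize L i g x = g x := by
  have : ⌊x i / L⌋ = 0 := by
    rw [Int.floor_eq_zero_iff]
    exact ⟨div_nonneg h0.le (h0.trans h1).le, (div_lt_one (h0.trans h1)).2 h1⟩
  simp [periodize, this]

lemma periodize_eq_zero {L : ℝ} {i k : Fin 3} (hik : k ≠ i) {g : Pt → ℝ}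
    (hg : ∀ x : Pt, ¬(0 < x k ∧ x k < L) → g x = 0) (x : Pt) (hx : ¬(0 < x k ∧ x k < L)) :
    periodize L i g x = 0 :=
  hg _ (by simpa [hik] using hx)

lemma contDiff_periodize {L : ℝ} (hL : 0 < L) {i : Fin 3} {g : Pt → ℝ} (hg : ContDiff ℝ ∞ g)
    (h0 : ∀ x : Pt, ¬(0 < x i ∧ x i < L) → g x = 0) : ContDiff ℝ ∞ (periodize L i g) := by
  rw [contDiff_iff_contDiffAt]
  intro x
  set n : ℤ := ⌊x i / L⌋ with hn
  -- Near `x` the floor takes only the values `n` and `n - 1`. The translate belonging to the other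
  -- cell vanishes there by `h0`, so the periodization is locally the sum of both translates.
  have hH : ContDiffAt ℝ ∞ (fun y : Pt => g (y - Pi.single i (n * L)) +
      g (y - Pi.single i ((n - 1) * L))) x := by
    refine ContDiff.contDiffAt ?_
    exact (hg.comp (contDiff_id.sub contDiff_const)).add
      (hg.comp (contDiff_id.sub contDiff_const))
  refine hH.congr_of_eventuallyEq ?_
  have hc : Continuous fun y : Pt => y i / L := by fun_prop
  have h1 : ∀ᶠ y : Pt in nhds x, (n : ℝ) - 1 < y i / L :=
    hc.continuousAt.eventually (lt_mem_nhds (by linarith [Int.floor_le (x i / L)]))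
  have h2 : ∀ᶠ y : Pt in nhds x, y i / L < n + 1 :=
    hc.continuousAt.eventually (gt_mem_nhds (Int.lt_floor_add_one (x i / L)))
  filter_upwards [h1, h2] with y hy1 hy2
  rw [lt_div_iff₀ hL] at hy1
  rw [div_lt_iff₀ hL] at hy2
  unfold periodize
  by_cases hyn : (n : ℝ) ≤ y i / L
  · have hf : ⌊y i / L⌋ = n := by
      rw [Int.floor_eq_iff]
      exact ⟨hyn, by rwa [div_lt_iff₀ hL]⟩
    rw [le_div_iff₀ hL] at hyn
    have hz : g (y - Pi.single i ((n - 1) * L)) = 0 := by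
      refine h0 _ ?_
      simp only [Pi.sub_apply, Pi.single_eq_same, not_and, not_lt]
      intro _; linarith
    simp only [hf, hz, add_zero]
  · have hf : ⌊y i / L⌋ = n - 1 := by
      rw [Int.floor_eq_iff]
      push_cast
      exact ⟨by rw [le_div_iff₀ hL]; exact hy1.le, by linarith⟩
    rw [not_le, div_lt_iff₀ hL] at hyn
    have hz : g (y - Pi.single i (n * L)) = 0 := by
      refine h0 _ ?_
      simp only [Pi.sub_apply, Pi.single_eq_same, not_and, not_lt]
      intro h; linarith
    simp only [hf, hz, zero_add]
    push_cast
    rfl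

/-! ### The vertical primitive -/

/-- The primitive in `z` that vanishes on `z = 0`. -/
noncomputable def zPrimitive (G : Pt → ℝ) (x : Pt) : ℝ :=
  ∫ s in (0 : ℝ)..x 2, G ![x 0, x 1, s]

/-- Writing the primitive as a convolution with the Heaviside function gives joint smoothness in all
three variables from the theorem on convolutions with parameters. -/
lemma zPrimitive_eq_convolution {L : ℝ} {G : Pt → ℝ} (hG : Continuous G)
    (h0 : ∀ x : Pt, ¬(0 < x 2 ∧ x 2 < L) → G x = 0) (x : Pt) :
    zPrimitive G x = convolution ((Ioi (0 : ℝ)).indicator fun _ => (1 : ℝ))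
      (fun s => G ![x 0, x 1, s]) (ContinuousLinearMap.mul ℝ ℝ) volume (x 2) := by
  set γ : ℝ → ℝ := fun s => G ![x 0, x 1, s] with hγ
  have hγc : Continuous γ := by
    refine hG.comp (continuous_pi fun k => ?_)
    fin_cases k
    · exact continuous_const
    · exact continuous_const
    · exact continuous_id
  have hγ0 : ∀ s, ¬(0 < s ∧ s < L) → γ s = 0 := fun s hs => h0 _ (by simpa using hs)
  have hcs : HasCompactSupport γ := by
    refine HasCompactSupport.intro (isCompact_Icc (a := 0) (b := L)) fun s hs => hγ0 s fun h => ?_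
    exact hs ⟨h.1.le, h.2.le⟩
  have hint : Integrable γ := hγc.integrable_of_hasCompactSupport hcs
  have e : ∀ t, ((Ioi (0 : ℝ)).indicator (fun _ => (1 : ℝ)) t) * γ (x 2 - t) =
      (Iio (x 2)).indicator γ (x 2 - t) := by
    intro t
    by_cases ht : 0 < t
    · simp [indicator, ht]
    · simp [indicator, ht]
  have hL0 : ∫ s in Iic (0 : ℝ), γ s = 0 :=
    setIntegral_eq_zero_of_forall_eq_zero fun s hs => hγ0 s fun h => absurd h.1 (not_lt.2 hs)
  simp only [convolution, ContinuousLinearMap.mul_apply', e]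
  rw [integral_sub_left_eq_self (fun s => (Iio (x 2)).indicator γ s) volume (x 2),
    integral_indicator measurableSet_Iio, ← integral_Iic_eq_integral_Iio, zPrimitive,
    ← intervalIntegral.integral_Iic_sub_Iic hint.integrableOn hint.integrableOn, hL0, sub_zero]

lemma contDiff_zPrimitive {L : ℝ} {G : Pt → ℝ} (hG : ContDiff ℝ ∞ G)
    (h0 : ∀ x : Pt, ¬(0 < x 2 ∧ x 2 < L) → G x = 0) : ContDiff ℝ ∞ (zPrimitive G) := by
  rw [funext (zPrimitive_eq_convolution hG.continuous h0), ← contDiffOn_univ]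
  refine contDiffOn_convolution_right_with_param_comp (n := ⊤) (ContinuousLinearMap.mul ℝ ℝ)
    (v := fun x : Pt => x 2) (g := fun (x : Pt) s => G ![x 0, x 1, s]) (k := Icc 0 L)
    (by fun_prop) isOpen_univ isCompact_Icc ?_ ?_ ?_
  · intro x s _ hs
    exact h0 _ fun h => hs ⟨h.1.le, h.2.le⟩
  · exact (locallyIntegrable_const 1).indicator measurableSet_Ioi
  · rw [univ_prod_univ, contDiffOn_univ]
    refine hG.comp (contDiff_pi.2 fun k => ?_)
    fin_cases k
    · exact show ContDiff ℝ ∞ fun q : Pt × ℝ => q.1 0 by fun_prop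
    · exact show ContDiff ℝ ∞ fun q : Pt × ℝ => q.1 1 by fun_prop
    · exact contDiff_snd

lemma partialD_zPrimitive {L : ℝ} {G : Pt → ℝ} (hG : ContDiff ℝ ∞ G)
    (h0 : ∀ x : Pt, ¬(0 < x 2 ∧ x 2 < L) → G x = 0) (x : Pt) :
    partialD (zPrimitive G) 2 x = G x := by
  have h1 : HasDerivAt (fun z => zPrimitive G (Function.update x 2 z))
      (partialD (zPrimitive G) 2 x) (x 2) := by
    have hd := ((contDiff_zPrimitive hG h0).differentiable (by simp)
      (Function.update x 2 (x 2))).hasFDerivAt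
    have := hd.comp_hasDerivAt (x 2) (hasDerivAt_update x 2 (x 2))
    simp only [Function.update_eq_self] at this
    exact this
  have hγ : Continuous fun s : ℝ => G ![x 0, x 1, s] := by
    refine hG.continuous.comp (continuous_pi fun k => ?_)
    fin_cases k
    · exact continuous_const
    · exact continuous_const
    · exact continuous_id
  have h2 : HasDerivAt (fun z => zPrimitive G (Function.update x 2 z))
      (G ![x 0, x 1, x 2]) (x 2) := by
    have := (hγ.integral_hasStrictDerivAt 0 (x 2)).hasDerivAt
    simpa [zPrimitive] using this
  rw [h1.unique h2]
  congr 1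
  ext k; fin_cases k <;> rfl

lemma zPrimitive_add_single {L : ℝ} {i : Fin 3} (hi : i ≠ 2) {G : Pt → ℝ}
    (hG : ∀ x, G (x + Pi.single i L) = G x) (x : Pt) :
    zPrimitive G (x + Pi.single i L) = zPrimitive G x := by
  unfold zPrimitive
  have h2 : (x + Pi.single i L : Pt) 2 = x 2 := by simp [Ne.symm hi]
  rw [h2]
  refine intervalIntegral.integral_congr fun s _ => ?_
  rw [← hG ![x 0, x 1, s]]
  congr 1
  ext k
  fin_cases k <;> fin_cases i <;> simp_all

/-- The function (L − z)ψ² vanishes on both walls, so its z-derivative 2(L − z)ψ ∂_zψ − ψ² has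
integral zero. Subtracting twice this derivative leaves a pointwise inequality that follows from (ψ
− 2(L − z)∂_zψ)² ≥ 0. -/
lemma integral_sq_le_of_eq_zero_bottom {L : ℝ} (hL : 0 < L) {ψ : Pt → ℝ} (hψ : ContDiff ℝ ∞ ψ)
    (h0 : ∀ x : Pt, x 2 = 0 → ψ x = 0) :
    ∫ x in Omega L, ψ x ^ 2 ≤ (2 * L) ^ 2 * ∫ x in Omega L, partialD ψ 2 x ^ 2 := by
  have hF : ContDiff ℝ ∞ fun x : Pt => (L - x 2) * (ψ x * ψ x) :=
    (contDiff_const.sub (contDiff_apply ℝ ℝ (2 : Fin 3))).mul (hψ.mul hψ)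
  have hI := integral_partialD hL hF 2
  have z1 : ∀ y : Fin 2 → ℝ, ψ ((2 : Fin 3).insertNth 0 y) = 0 := fun y => h0 _ (by simp)
  simp only [z1, Fin.insertNth_apply_same, sub_self, zero_mul, mul_zero, integral_zero] at hI
  have hd : ∀ x, partialD (fun x : Pt => (L - x 2) * (ψ x * ψ x)) 2 x =
      2 * (L - x 2) * (ψ x * partialD ψ 2 x) - ψ x ^ 2 := by
    intro x
    have hψd := hψ.differentiable (by simp) x
    rw [partialD_mul (f := fun x : Pt => L - x 2) (by fun_prop) (hψd.fun_mul hψd),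
      partialD_mul hψd hψd]
    have : partialD (fun y : Pt => L - y 2) 2 x = -1 := by
      simp only [partialD]
      rw [fderiv_const_sub]
      have := partialD_coord 2 2 x
      simp only [partialD, if_true] at this
      simp [this]
    rw [this]; ring
  have hp := continuous_partialD hψ 2
  have hmono : ∫ x in Omega L, ψ x ^ 2 ≤ ∫ x in Omega L, ((2 * L) ^ 2 * partialD ψ 2 x ^ 2 -
      2 * partialD (fun x : Pt => (L - x 2) * (ψ x * ψ x)) 2 x) := by
    refine setIntegral_mono_on (integrableOn_Omega_of_continuous L (hψ.continuous.pow 2))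
      (integrableOn_Omega_of_continuous L ((continuous_const.mul (hp.pow 2)).sub
        (continuous_const.mul (continuous_partialD hF 2)))) (measurableSet_Omega L) ?_
    intro x hx
    rw [hd]
    obtain ⟨hx0, hx1⟩ := hx 2
    have : (L - x 2) ^ 2 * partialD ψ 2 x ^ 2 ≤ L ^ 2 * partialD ψ 2 x ^ 2 := by
      gcongr
      linarith
    nlinarith [sq_nonneg (ψ x - 2 * (L - x 2) * partialD ψ 2 x)]
  rw [integral_sub, integral_const_mul, integral_const_mul, hI] at hmono
  · simpa using hmono
  · exact integrableOn_Omega_of_continuous L (continuous_const.mul (hp.pow 2))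
  · exact integrableOn_Omega_of_continuous L (continuous_const.mul (continuous_partialD hF 2))

/-! ### Smooth functions with compact support in `Ω` are dense in `L²(Ω)` -/

lemma inner_toLp {μ : Measure Pt} {f g : Pt → ℝ} (hf : MemLp f 2 μ) (hg : MemLp g 2 μ) :
    inner ℝ (hf.toLp f) (hg.toLp g) = ∫ x, f x * g x ∂μ := by
  rw [L2.inner_def]
  refine integral_congr_ae ?_
  filter_upwards [hf.coeFn_toLp, hg.coeFn_toLp] with x h1 h2
  simp [h1, h2, mul_comm]

lemma norm_toLp_sq {μ : Measure Pt} {f : Pt → ℝ} (hf : MemLp f 2 μ) :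
    ‖hf.toLp f‖ ^ 2 = ∫ x, f x ^ 2 ∂μ := by
  rw [← real_inner_self_eq_norm_sq, inner_toLp]
  simp only [pow_two]

/-- The classes in `L²(Ω)` of the smooth functions with compact support in `Ω`. -/
def testFunctions (L : ℝ) : Submodule ℝ (Lp ℝ 2 (volume.restrict (Omega L))) where
  carrier := {w | ∃ g : Pt → ℝ, ContDiff ℝ ∞ g ∧ HasCompactSupport g ∧ tsupport g ⊆ Omega L ∧
    w =ᵐ[volume.restrict (Omega L)] g}
  zero_mem' := ⟨fun _ => 0, contDiff_const, HasCompactSupport.zero, by simp [tsupport],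
    Lp.coeFn_zero ℝ 2 _⟩
  add_mem' := by
    rintro a b ⟨f, hf, hfc, hfs, hfe⟩ ⟨g, hg, hgc, hgs, hge⟩
    refine ⟨f + g, hf.add hg, hfc.add hgc, (tsupport_add f g).trans (union_subset hfs hgs), ?_⟩
    filter_upwards [Lp.coeFn_add a b, hfe, hge] with x h1 h2 h3
    rw [h1, Pi.add_apply, Pi.add_apply, h2, h3]
  smul_mem' := by
    rintro c a ⟨f, hf, hfc, hfs, hfe⟩
    refine ⟨fun x => c * f x, contDiff_const.mul hf, hfc.mul_left,
      (closure_mono fun x hx => ?_).trans hfs, ?_⟩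
    · simp only [Function.mem_support] at hx ⊢
      exact right_ne_zero_of_mul hx
    · filter_upwards [Lp.coeFn_smul c a, hfe] with x h1 h2
      simp [h1, h2]

/-- An element orthogonal to all test functions vanishes almost everywhere, by the fundamental lemma
of the calculus of variations. -/
lemma dense_testFunctions (L : ℝ) :
    Dense (testFunctions L : Set (Lp ℝ 2 (volume.restrict (Omega L)))) := by
  rw [Submodule.dense_iff_topologicalClosure_eq_top, Submodule.topologicalClosure_eq_top_iff,
    Submodule.eq_bot_iff]
  intro w hw
  have hwL : MemLp w 2 (volume.restrict (Omega L)) := Lp.memLp w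
  have hz : ∀ᵐ x ∂volume, x ∈ Omega L → (w : Pt → ℝ) x = 0 := by
    refine (isOpen_Omega L).ae_eq_zero_of_integral_contDiff_smul_eq_zero ?_ ?_
    · exact (show IntegrableOn (w : Pt → ℝ) (Omega L) volume from
        hwL.integrable (by norm_num)).locallyIntegrableOn
    · intro g hg hgc hgs
      have hgL := memLp_of_continuous L 2 hg.continuous
      have hmem : hgL.toLp g ∈ testFunctions L := ⟨g, hg, hgc, hgs, hgL.coeFn_toLp⟩
      have h := (Submodule.mem_orthogonal _ _).1 hw _ hmem
      rw [← Lp.toLp_coeFn w hwL, inner_toLp] at h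
      rw [← h]
      refine (setIntegral_eq_integral_of_forall_compl_eq_zero fun x hx => ?_).symm
      have : g x = 0 := image_eq_zero_of_notMem_tsupport fun h => hx (hgs h)
      simp [this]
  rw [Lp.eq_zero_iff_ae_eq_zero]
  exact (ae_restrict_iff' (measurableSet_Omega L)).2 hz

/-! ### The Poincaré inequality -/

/-- Extend `g` periodically in x and y and let ψ be its vertical primitive. The trace condition with
wall velocity 0 gives ∫ v_j g = −∫ ∂_z v_j ψ, and ‖ψ‖ ≤ 2L‖g‖. The function ψ need not vanish on the
upper wall, because `v` does. -/
lemma abs_integral_mul_le {L : ℝ} (hL : 0 < L) {v : VField} (hv : MemX L 0 v) (j : Fin 3)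
    {g : Pt → ℝ} (hg : ContDiff ℝ ∞ g) (hgs : tsupport g ⊆ Omega L) :
    |∫ x in Omega L, v.1 x j * g x| ≤ ‖(hv.memH1.grad_memLp 2 j).toLp _‖ *
      (2 * L * ‖(memLp_of_continuous L 2 hg.continuous).toLp g‖) := by
  have hz : ∀ x : Pt, x ∉ Omega L → g x = 0 := fun x hx =>
    image_eq_zero_of_notMem_tsupport fun h => hx (hgs h)
  have hzk : ∀ k : Fin 3, ∀ x : Pt, ¬(0 < x k ∧ x k < L) → g x = 0 := fun k x hx =>
    hz x fun h => hx (h k)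
  set G : Pt → ℝ := periodize L 0 (periodize L 1 g) with hGdef
  have hG : ContDiff ℝ ∞ G := contDiff_periodize hL (contDiff_periodize hL hg (hzk 1))
    (periodize_eq_zero (by decide) (hzk 0))
  have hG0 : ∀ x, G (x + Pi.single 0 L) = G x := periodize_add_single hL 0 _
  have hG1 : ∀ x, G (x + Pi.single 1 L) = G x :=
    periodize_add_single_of_ne (by decide) (periodize_add_single hL 1 _)
  have hG2 : ∀ x : Pt, ¬(0 < x 2 ∧ x 2 < L) → G x = 0 :=
    periodize_eq_zero (by decide) (periodize_eq_zero (by decide) (hzk 2))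
  have hGg : ∀ x ∈ Omega L, G x = g x := fun x hx => by
    rw [hGdef, periodize_eq_self (hx 0).1 (hx 0).2, periodize_eq_self (hx 1).1 (hx 1).2]
  have hψ := contDiff_zPrimitive hG hG2
  have htr := hv.traces (zPrimitive G) hψ (zPrimitive_add_single (by decide) hG0)
    (zPrimitive_add_single (by decide) hG1) 2 j
  simp only [partialD_zPrimitive hG hG2, zero_mul, ite_self] at htr
  rw [integral_add (integrable_mul_of_continuous (by norm_num) (hv.memH1.val_memLp j)
      hG.continuous) (integrable_mul_of_continuous (by norm_num) (hv.memH1.grad_memLp 2 j)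
      hψ.continuous)] at htr
  have e1 : ∫ x in Omega L, v.1 x j * G x = ∫ x in Omega L, v.1 x j * g x :=
    setIntegral_congr_fun (measurableSet_Omega L) fun x hx => by simp only [hGg x hx]
  have hψL := memLp_of_continuous L 2 hψ.continuous
  have e2 := inner_toLp (hv.memH1.grad_memLp 2 j) hψL
  have hnorm : ‖hψL.toLp _‖ ≤ 2 * L * ‖(memLp_of_continuous L 2 hg.continuous).toLp g‖ := by
    refine le_of_sq_le_sq ?_ (by positivity)
    rw [mul_pow, norm_toLp_sq, norm_toLp_sq]
    refine (integral_sq_le_of_eq_zero_bottom hL hψ fun x hx => ?_).trans (le_of_eq ?_)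
    · simp [zPrimitive, hx]
    · congr 1
      refine setIntegral_congr_fun (measurableSet_Omega L) fun x hx => ?_
      simp only [partialD_zPrimitive hG hG2, hGg x hx]
  rw [← e1, eq_neg_of_add_eq_zero_left htr, abs_neg, ← e2]
  exact (abs_real_inner_le_norm _ _).trans (by gcongr)

/-- The Poincaré inequality for fields that vanish on the walls. -/
lemma poincare {L : ℝ} (hL : 0 < L) {v : VField} (hv : MemX L 0 v) (j : Fin 3) :
    ∫ x in Omega L, v.1 x j ^ 2 ≤ (2 * L) ^ 2 * ∫ x in Omega L, v.2 x 2 j ^ 2 := by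
  set V := (hv.memH1.val_memLp j).toLp _ with hV
  set W := (hv.memH1.grad_memLp 2 j).toLp _ with hW
  -- The dual estimate is a closed condition on `w`, so density extends it to all of L². Taking `w =
  -- V` then gives ‖V‖² ≤ 2L‖W‖‖V‖.
  have hclosed : IsClosed {w : Lp ℝ 2 (volume.restrict (Omega L)) |
      |inner ℝ V w| ≤ ‖W‖ * (2 * L * ‖w‖)} :=
    isClosed_le (by fun_prop) (by fun_prop)
  have hsub : (testFunctions L : Set _) ⊆ {w : Lp ℝ 2 (volume.restrict (Omega L)) |
      |inner ℝ V w| ≤ ‖W‖ * (2 * L * ‖w‖)} := by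
    rintro w ⟨g, hg, -, hgs, hwg⟩
    have hw : w = (memLp_of_continuous L 2 hg.continuous).toLp g := by
      refine Lp.ext ?_
      exact hwg.trans (MemLp.coeFn_toLp _).symm
    rw [mem_ofPred_eq, hw, hV, inner_toLp]
    exact abs_integral_mul_le hL hv j hg hgs
  have hmem : V ∈ {w : Lp ℝ 2 (volume.restrict (Omega L)) |
      |inner ℝ V w| ≤ ‖W‖ * (2 * L * ‖w‖)} :=
    hclosed.closure_subset_iff.2 hsub (dense_testFunctions L V)
  rw [mem_ofPred_eq, real_inner_self_eq_norm_sq, abs_of_nonneg (by positivity)] at hmem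
  have hle : ‖V‖ ≤ 2 * L * ‖W‖ := by
    rcases (norm_nonneg V).eq_or_lt with h | h
    · rw [← h]; positivity
    · exact le_of_mul_le_mul_right (by nlinarith) h
  rw [← norm_toLp_sq (hv.memH1.val_memLp j), ← norm_toLp_sq (hv.memH1.grad_memLp 2 j), ← mul_pow]
  gcongr

/-! ### Integrability -/

lemma gradNorm_nonneg (u : VField) (x : Pt) : 0 ≤ gradNorm u x := Real.sqrt_nonneg _

lemma gradNorm_sq (u : VField) (x : Pt) : gradNorm u x ^ 2 = ∑ i, ∑ j, u.2 x i j ^ 2 :=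
  Real.sq_sqrt (Finset.sum_nonneg fun _ _ => Finset.sum_nonneg fun _ _ => sq_nonneg _)

lemma abs_grad_le_gradNorm (u : VField) (x : Pt) (i j : Fin 3) : |u.2 x i j| ≤ gradNorm u x := by
  refine Real.abs_le_sqrt ?_
  refine le_trans ?_ (Finset.single_le_sum (f := fun i => ∑ j, u.2 x i j ^ 2)
    (fun _ _ => Finset.sum_nonneg fun _ _ => sq_nonneg _) (Finset.mem_univ i))
  exact Finset.single_le_sum (f := fun j => u.2 x i j ^ 2) (fun _ _ => sq_nonneg _)
    (Finset.mem_univ j)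

lemma gradNorm_le_sum (u : VField) (x : Pt) : gradNorm u x ≤ ∑ i, ∑ j, |u.2 x i j| := by
  refine Real.sqrt_le_iff.2 ⟨Finset.sum_nonneg fun _ _ => Finset.sum_nonneg fun _ _ =>
    abs_nonneg _, ?_⟩
  rw [← Finset.sum_product', ← Finset.sum_product']
  simp only [← sq_abs (u.2 x _ _)]
  exact Finset.sum_sq_le_sq_sum_of_nonneg fun _ _ => abs_nonneg _

lemma memLp_gradNorm {L : ℝ} {u : VField} (hu : MemSobolev L 3 u) :
    MemLp (gradNorm u) 3 (volume.restrict (Omega L)) := by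
  have hH : MemLp (fun x => ∑ i, ∑ j, |u.2 x i j|) 3 (volume.restrict (Omega L)) :=
    memLp_finsetSum _ fun i _ => memLp_finsetSum _ fun j _ => (hu.grad_memLp i j).abs
  refine hH.mono ?_ (Eventually.of_forall fun x => ?_)
  · refine Real.continuous_sqrt.comp_aestronglyMeasurable ?_
    refine Finset.aestronglyMeasurable_fun_sum _ fun i _ =>
      Finset.aestronglyMeasurable_fun_sum _ fun j _ => ?_
    exact (hu.grad_memLp i j).aestronglyMeasurable.pow 2
  · rw [Real.norm_of_nonneg (gradNorm_nonneg u x)]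
    exact (gradNorm_le_sum u x).trans (le_abs_self _)

lemma integrable_pow_three {μ : Measure Pt} {f : Pt → ℝ} (hf : MemLp f 3 μ) :
    Integrable (fun x => |f x| ^ 3) μ := by
  simpa using hf.integrable_norm_pow (p := 3) (by norm_num)

/-- The convection and Smagorinsky integrands are sums of products of three L³ functions, so W^{1,3}
regularity suffices without any Sobolev embedding. -/
lemma integrable_mul_mul {μ : Measure Pt} {f g k : Pt → ℝ} (hf : MemLp f 3 μ) (hg : MemLp g 3 μ)
    (hk : MemLp k 3 μ) : Integrable (fun x => f x * g x * k x) μ := by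
  refine Integrable.mono' (((integrable_pow_three hf).add (integrable_pow_three hg)).add
    (integrable_pow_three hk)) ((hf.aestronglyMeasurable.mul hg.aestronglyMeasurable).mul
    hk.aestronglyMeasurable) (Eventually.of_forall fun x => ?_)
  have amgm : ∀ a b c : ℝ, 0 ≤ a → 0 ≤ b → 0 ≤ c → a * b * c ≤ a ^ 3 + b ^ 3 + c ^ 3 := by
    intro a b c ha hb hc
    nlinarith [mul_nonneg (add_nonneg (add_nonneg ha hb) hc) (add_nonneg (add_nonneg
      (sq_nonneg (a - b)) (sq_nonneg (b - c))) (sq_nonneg (c - a))), pow_nonneg ha 3,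
      pow_nonneg hb 3, pow_nonneg hc 3]
  simpa [abs_mul] using amgm _ _ _ (abs_nonneg (f x)) (abs_nonneg (g x)) (abs_nonneg (k x))

lemma memLp_two_of_three {L : ℝ} {f : Pt → ℝ} (hf : MemLp f 3 (volume.restrict (Omega L))) :
    MemLp f 2 (volume.restrict (Omega L)) := hf.mono_exponent (by norm_num)

lemma integrable_mul_three {L : ℝ} {f g : Pt → ℝ} (hf : MemLp f 3 (volume.restrict (Omega L)))
    (hg : MemLp g 3 (volume.restrict (Omega L))) :
    Integrable (fun x => f x * g x) (volume.restrict (Omega L)) :=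
  (memLp_two_of_three hf).integrable_mul (memLp_two_of_three hg)

lemma integrable_dissipation {L : ℝ} {u : VField} (hu : MemSobolev L 3 u) (ν κ : ℝ) :
    Integrable (fun x => ν * gradNorm u x ^ 2 + κ * gradNorm u x ^ 3)
      (volume.restrict (Omega L)) := by
  have hG := memLp_gradNorm hu
  refine Integrable.add (Integrable.const_mul ?_ _) (Integrable.const_mul ?_ _)
  · exact (memLp_two_of_three hG).integrable_sq
  · simpa only [abs_of_nonneg (gradNorm_nonneg u _)] using integrable_pow_three hG

lemma integrable_gradIp {L : ℝ} {u v : VField} (hu : MemSobolev L 3 u) (hv : MemSobolev L 3 v) :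
    Integrable (fun x => ∑ i, ∑ j, u.2 x i j * v.2 x i j) (volume.restrict (Omega L)) :=
  integrable_finsetSum _ fun i _ => integrable_finsetSum _ fun j _ =>
    integrable_mul_three (hu.grad_memLp i j) (hv.grad_memLp i j)

lemma integrable_smagForm {L : ℝ} {u v : VField} (hu : MemSobolev L 3 u)
    (hv : MemSobolev L 3 v) :
    Integrable (fun x => ∑ i, ∑ j, gradNorm u x * u.2 x i j * v.2 x i j)
      (volume.restrict (Omega L)) :=
  integrable_finsetSum _ fun i _ => integrable_finsetSum _ fun j _ =>
    integrable_mul_mul (memLp_gradNorm hu) (hu.grad_memLp i j) (hv.grad_memLp i j)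

lemma integrable_convect {L : ℝ} {u v w : VField} (hu : MemSobolev L 3 u)
    (hv : MemSobolev L 3 v) (hw : MemSobolev L 3 w) :
    Integrable (fun x => ∑ j, (∑ i, u.1 x i * v.2 x i j) * w.1 x j)
      (volume.restrict (Omega L)) := by
  refine integrable_finsetSum _ fun j _ => ?_
  simp only [Finset.sum_mul]
  exact integrable_finsetSum _ fun i _ =>
    integrable_mul_mul (hu.val_memLp i) (hv.grad_memLp i j) (hw.val_memLp j)

/-! ### Pointwise estimates -/

/-- Young's inequality with exponents 3/2 and 3, obtained by comparing `8 * a` with `κ * G`. It lets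
the cubic dissipation absorb quadratic terms. -/
lemma mul_sq_le_cube_add {a G κ : ℝ} (ha : 0 ≤ a) (hG : 0 ≤ G) (hκ : 0 < κ) :
    a * G ^ 2 ≤ κ * G ^ 3 / 8 + 64 * (a ^ 3 / κ ^ 2) := by
  have h3 : 0 ≤ a ^ 3 / κ ^ 2 := by positivity
  rcases le_total (8 * a) (κ * G) with h | h
  · have := mul_le_mul_of_nonneg_right h (sq_nonneg G)
    nlinarith
  · have hG' : G ≤ 8 * a / κ := by rw [le_div_iff₀ hκ]; linarith
    have h1 : a * G ^ 2 ≤ a * (8 * a / κ) ^ 2 := by gcongr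
    have h2 : a * (8 * a / κ) ^ 2 = 64 * (a ^ 3 / κ ^ 2) := by field_simp; ring
    have h4 : 0 ≤ κ * G ^ 3 := by positivity
    linarith

lemma sq_mul_le_cube_add {G β : ℝ} (hG : 0 ≤ G) (hβ : 0 ≤ β) :
    G ^ 2 * β ≤ G ^ 3 / 4 + 16 * β ^ 3 := by
  have h3 : 0 ≤ G ^ 3 := by positivity
  have h4 : 0 ≤ β ^ 3 := by positivity
  rcases le_total (4 * β) G with h | h
  · nlinarith [mul_le_mul_of_nonneg_right h (sq_nonneg G)]
  · have : G ^ 2 ≤ (4 * β) ^ 2 := by gcongr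
    nlinarith [mul_le_mul_of_nonneg_right this hβ]

/-- Here `V` and `E` are the values of v and ∇v at a point. The term ∑V² is kept paired with
(2L)²∑E², since the Poincaré inequality controls this difference only after integration. The term in
`E 0 0 * z ^ 2` is not estimated, since its integral is zero. -/
lemma convection_lower_bound {V : Fin 3 → ℝ} {E : Fin 3 → Fin 3 → ℝ} {β z L : ℝ} (hβ : 0 ≤ β)
    (hz : 0 ≤ z) (hzL : z ≤ L) :
    -(3 / 8 * β * (∑ j, V j ^ 2 - (2 * L) ^ 2 * ∑ i, ∑ j, E i j ^ 2)) -
        2 * β * L ^ 2 * (∑ i, ∑ j, E i j ^ 2) - 1 / 2 * β ^ 2 * (E 0 0 * z ^ 2) ≤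
      1 / 2 * (β * (V 2 * V 0) - β * z * (∑ i, V i * E i 0) - β ^ 2 * (E 0 0 * z ^ 2)) := by
  have h1 : -(V 2 * V 0) ≤ 1 / 2 * ∑ j, V j ^ 2 := by
    rw [Fin.sum_univ_three]; nlinarith [sq_nonneg (V 2 + V 0), sq_nonneg (V 1)]
  have h2 : z * (∑ i, V i * E i 0) ≤ 1 / 4 * (∑ j, V j ^ 2) + L ^ 2 * ∑ i, ∑ j, E i j ^ 2 := by
    rw [Finset.mul_sum, Finset.mul_sum, Finset.mul_sum, ← Finset.sum_add_distrib]
    refine Finset.sum_le_sum fun i _ => ?_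
    have hle : E i 0 ^ 2 ≤ ∑ j, E i j ^ 2 :=
      Finset.single_le_sum (f := fun j => E i j ^ 2) (fun _ _ => sq_nonneg _) (Finset.mem_univ 0)
    have hzz : z ^ 2 * E i 0 ^ 2 ≤ L ^ 2 * ∑ j, E i j ^ 2 := by gcongr
    nlinarith [sq_nonneg (V i / 2 - z * E i 0)]
  nlinarith [mul_le_mul_of_nonneg_left h1 hβ, mul_le_mul_of_nonneg_left h2 hβ]

/-! ### The energy lower bound -/

/-- The bound for half of the dissipation rate, for wall velocity `U` and `κ = (C_s δ)²`. -/
noncomputable def dissipationBound (L U ν κ : ℝ) : ℝ :=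
  ν * (U / L) ^ 2 + 17 * (κ * (U / L) ^ 3) + 8192 * ((U * L) ^ 3 / κ ^ 2)

lemma pointwise_energy_bound {L U ν κ : ℝ} (hL : 0 < L) (hU : 0 < U) (hν : 0 < ν) (hκ : 0 < κ)
    (w : VField) {x : Pt} (hx : x ∈ Omega L) :
    1 / 2 * (ν * gradNorm w x ^ 2 + κ * gradNorm w x ^ 3) - dissipationBound L U ν κ -
        3 / 8 * (U / L) * (∑ j, (w - couette L U).1 x j ^ 2 -
          (2 * L) ^ 2 * ∑ i, ∑ j, (w - couette L U).2 x i j ^ 2) -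
        1 / 2 * (U / L) ^ 2 * ((w - couette L U).2 x 0 0 * x 2 ^ 2) ≤
      ν * (∑ i, ∑ j, w.2 x i j * (w - couette L U).2 x i j) +
        (1 / 2 * (∑ j, (∑ i, w.1 x i * w.2 x i j) * (w - couette L U).1 x j) -
          1 / 2 * ∑ j, (∑ i, w.1 x i * (w - couette L U).2 x i j) * w.1 x j) +
        κ * ∑ i, ∑ j, gradNorm w x * w.2 x i j * (w - couette L U).2 x i j := by
  set V : Fin 3 → ℝ := (w - couette L U).1 x with hV
  set E : Fin 3 → Fin 3 → ℝ := (w - couette L U).2 x with hE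
  set D : Fin 3 → Fin 3 → ℝ := w.2 x with hD
  set G := gradNorm w x with hG
  set β := U / L with hβdef
  have hβ : 0 < β := div_pos hU hL
  have hG0 : 0 ≤ G := gradNorm_nonneg w x
  have hGsq : G ^ 2 = ∑ i, ∑ j, D i j ^ 2 := gradNorm_sq w x
  have hD20 : |D 2 0| ≤ G := abs_grad_le_gradNorm w x 2 0
  have hED : ∀ i j, E i j = D i j - if i = 2 ∧ j = 0 then β else 0 := fun i j => rfl
  have hVw : ∀ j, w.1 x j = V j + if j = 0 then β * x 2 else 0 := fun j => by
    rw [← couette_val, hV]; simp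
  have hconv := convection_lower_bound (V := V) (E := E) hβ.le (hx 2).1.le (hx 2).2.le
  -- The part (w·∇v)·v cancels pointwise thanks to the skew-symmetric form, so no divergence
  -- constraint on `w` is used.
  have htri : 1 / 2 * (∑ j, (∑ i, w.1 x i * D i j) * V j) -
      1 / 2 * ∑ j, (∑ i, w.1 x i * E i j) * w.1 x j =
      1 / 2 * (β * (V 2 * V 0) - β * x 2 * (∑ i, V i * E i 0) -
        β ^ 2 * (E 0 0 * x 2 ^ 2)) := by
    have hDE : ∀ i j, D i j = E i j + if i = 2 ∧ j = 0 then β else 0 := fun i j => by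
      rw [hED]; ring
    simp only [Fin.sum_univ_three, hVw, hDE]
    simp
    ring
  have hgrad : ∑ i, ∑ j, D i j * E i j = G ^ 2 - β * D 2 0 := by
    rw [hGsq]
    simp only [Fin.sum_univ_three, hED]
    simp
    ring
  have hsmag : ∑ i, ∑ j, G * D i j * E i j = G * (G ^ 2 - β * D 2 0) := by
    rw [← hgrad]
    simp only [Finset.mul_sum, mul_assoc]
  have hEsq : ∑ i, ∑ j, E i j ^ 2 ≤ 2 * G ^ 2 + 2 * β ^ 2 := by
    have : ∑ i, ∑ j, E i j ^ 2 = G ^ 2 - 2 * β * D 2 0 + β ^ 2 := by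
      rw [hGsq]
      simp only [Fin.sum_univ_three, hED]
      simp
      ring
    rw [this]
    have h1 : -(β * D 2 0) ≤ β * G := by
      have := mul_le_mul_of_nonneg_left ((neg_le_abs _).trans hD20) hβ.le
      linarith
    nlinarith [sq_nonneg (G - β)]
  have hβD : β * D 2 0 ≤ β * G := mul_le_mul_of_nonneg_left ((le_abs_self _).trans hD20) hβ.le
  rw [htri, hgrad, hsmag]
  have hUL : β * L ^ 2 = U * L := by rw [hβdef]; field_simp
  -- Budget: `y1` and `y3` use 1/8 + 1/4 of `κ * G ^ 3`, leaving more than the required half. The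
  -- constants left over are 2 · 4096 = 8192 and 16 + 1/8 ≤ 17.
  have y1 := mul_sq_le_cube_add (a := 4 * (U * L)) (by positivity) hG0 hκ
  have y2 := mul_sq_le_cube_add (a := 4 * (U * L)) (by positivity) hβ.le hκ
  have y3 := mul_le_mul_of_nonneg_left (sq_mul_le_cube_add hG0 hβ.le) hκ.le
  have y4 : 64 * ((4 * (U * L)) ^ 3 / κ ^ 2) = 4096 * ((U * L) ^ 3 / κ ^ 2) := by ring
  have y5 : 2 * β * L ^ 2 * (∑ i, ∑ j, E i j ^ 2) ≤ 2 * (U * L) * (2 * G ^ 2 + 2 * β ^ 2) := by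
    rw [← hUL]
    have := mul_le_mul_of_nonneg_left hEsq (by positivity : 0 ≤ 2 * (β * L ^ 2))
    linarith
  have y6 : κ * (G ^ 3 - G ^ 2 * β) ≤ κ * (G * (G ^ 2 - β * D 2 0)) := by
    have := mul_le_mul_of_nonneg_left hβD hG0
    refine mul_le_mul_of_nonneg_left ?_ hκ.le
    nlinarith
  have y7 : ν * (1 / 2 * G ^ 2 - β ^ 2) ≤ ν * (G ^ 2 - β * D 2 0) := by
    refine mul_le_mul_of_nonneg_left ?_ hν.le
    nlinarith [sq_nonneg (G - β)]
  have y8 : 0 ≤ κ * β ^ 3 := by positivity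
  have y9 : 0 ≤ κ * G ^ 3 := by positivity
  unfold dissipationBound
  rw [← hβdef]
  linarith

/-- Periodicity in x: the trace identity is tested with ψ = z², for which ∂_xψ = 0. -/
lemma integral_grad_mul_sq_height {L : ℝ} {v : VField} (hv : MemX L 0 v) :
    ∫ x in Omega L, v.2 x 0 0 * x 2 ^ 2 = 0 := by
  have h := hv.traces (fun x => x 2 ^ 2) (by fun_prop) (fun x => by simp) (fun x => by simp) 0 0
  have hp : ∀ x, partialD (fun y : Pt => y 2 ^ 2) 0 x = 0 := by
    intro x
    simp only [pow_two]
    rw [partialD_mul (by fun_prop) (by fun_prop), partialD_coord]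
    simp
  simpa [hp] using h

lemma energy_lower_bound {L U ν Cs δ : ℝ} (hL : 0 < L) (hU : 0 < U) (hν : 0 < ν) (hCs : 0 < Cs)
    (hδ : 0 < δ) {w : VField} (hw : MemSobolev L 3 w) (hwX : MemX L U w) :
    L ^ 3 * (1 / 2 * dissipation L ν Cs δ w - dissipationBound L U ν ((Cs * δ) ^ 2)) ≤
      ν * gradIp L w (w - couette L U) + trilin L w w (w - couette L U) +
        (Cs * δ) ^ 2 * smagForm L w (w - couette L U) := by
  set κ := (Cs * δ) ^ 2 with hκdef
  have hκ : 0 < κ := by positivity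
  set v := w - couette L U with hv
  have hv3 : MemSobolev L 3 v := hw.sub (by norm_num) (memSobolev_couette hL U 3)
  have hvX : MemX L 0 v := by
    have := hwX.sub (memX_couette hL U)
    rwa [sub_self] at this
  have i1 := integrable_gradIp hw hv3
  have i2 := integrable_convect hw hw hv3
  have i3 := integrable_convect hw hv3 hw
  have i4 := integrable_smagForm hw hv3
  have i5 := integrable_dissipation hw ν κ
  have i6 : ∀ j, Integrable (fun x => v.1 x j ^ 2) (volume.restrict (Omega L)) := fun j =>
    (hvX.memH1.val_memLp j).integrable_sq
  have i7 : ∀ i j, Integrable (fun x => v.2 x i j ^ 2) (volume.restrict (Omega L)) := fun i j =>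
    (hvX.memH1.grad_memLp i j).integrable_sq
  have i8 : Integrable (fun x => v.2 x 0 0 * x 2 ^ 2) (volume.restrict (Omega L)) :=
    integrable_mul_of_continuous (by norm_num) (hvX.memH1.grad_memLp 0 0) (by fun_prop)
  have i9 : Integrable (fun x => ∑ j, v.1 x j ^ 2) (volume.restrict (Omega L)) :=
    integrable_finsetSum _ fun j _ => i6 j
  have i10 : Integrable (fun x => ∑ i, ∑ j, v.2 x i j ^ 2) (volume.restrict (Omega L)) :=
    integrable_finsetSum _ fun i _ => integrable_finsetSum _ fun j _ => i7 i j
  have i11 := i9.sub (i10.const_mul ((2 * L) ^ 2))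
  -- Poincaré needs only the z-derivatives; the remaining ones are added because they are
  -- nonnegative.
  have hP : ∫ x in Omega L, (∑ j, v.1 x j ^ 2 - (2 * L) ^ 2 * ∑ i, ∑ j, v.2 x i j ^ 2) ≤ 0 := by
    rw [integral_sub i9 (i10.const_mul _), integral_const_mul, sub_nonpos,
      integral_finsetSum _ fun j _ => i6 j, integral_finsetSum _ fun i _ =>
      integrable_finsetSum _ fun j _ => i7 i j]
    calc ∑ j, ∫ x in Omega L, v.1 x j ^ 2
        ≤ ∑ j, (2 * L) ^ 2 * ∫ x in Omega L, v.2 x 2 j ^ 2 :=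
          Finset.sum_le_sum fun j _ => poincare hL hvX j
      _ = (2 * L) ^ 2 * ∫ x in Omega L, ∑ j, v.2 x 2 j ^ 2 := by
          rw [integral_finsetSum _ fun j _ => i7 2 j, Finset.mul_sum]
      _ ≤ (2 * L) ^ 2 * ∑ i, ∫ x in Omega L, ∑ j, v.2 x i j ^ 2 := by
          gcongr
          exact Finset.single_le_sum (f := fun i => ∫ x in Omega L, ∑ j, v.2 x i j ^ 2)
            (fun i _ => integral_nonneg fun x => Finset.sum_nonneg fun _ _ => sq_nonneg _)
            (Finset.mem_univ 2)
  have hmono := setIntegral_mono_on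
    ((((i5.const_mul (1 / 2)).sub (integrable_const (dissipationBound L U ν κ))).sub
      (i11.const_mul (3 / 8 * (U / L)))).sub (i8.const_mul (1 / 2 * (U / L) ^ 2)))
    (((i1.const_mul ν).add ((i2.const_mul (1 / 2)).sub (i3.const_mul (1 / 2)))).add
      (i4.const_mul κ)) (measurableSet_Omega L)
    (fun x hx => pointwise_energy_bound hL hU hν hκ w hx)
  have eR : ∫ x in Omega L, (((fun x => ν * ∑ i, ∑ j, w.2 x i j * v.2 x i j) +
      ((fun x => 1 / 2 * ∑ j, (∑ i, w.1 x i * w.2 x i j) * v.1 x j) -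
        fun x => 1 / 2 * ∑ j, (∑ i, w.1 x i * v.2 x i j) * w.1 x j)) +
      fun x => κ * ∑ i, ∑ j, gradNorm w x * w.2 x i j * v.2 x i j) x =
      ν * gradIp L w v + trilin L w w v + κ * smagForm L w v := by
    rw [integral_add' ((i1.const_mul ν).add ((i2.const_mul _).sub (i3.const_mul _)))
      (i4.const_mul κ), integral_add' (i1.const_mul ν) ((i2.const_mul _).sub (i3.const_mul _)),
      integral_sub' (i2.const_mul _) (i3.const_mul _)]
    simp only [integral_const_mul]
    rfl
  rw [eR] at hmono
  refine le_trans ?_ hmono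
  rw [integral_sub' (((i5.const_mul _).sub (integrable_const _)).sub (i11.const_mul _))
    (i8.const_mul _), integral_sub' ((i5.const_mul _).sub (integrable_const _)) (i11.const_mul _),
    integral_sub' (i5.const_mul _) (integrable_const _)]
  simp only [integral_const_mul, integral_const, measureReal_restrict_apply_univ,
    volume_real_Omega hL, integral_grad_mul_sq_height hvX, Pi.sub_apply, smul_eq_mul]
  have hP' := mul_nonpos_of_nonneg_of_nonpos (by positivity : 0 ≤ 3 / 8 * (U / L)) hP
  have hdis : L ^ 3 * dissipation L ν Cs δ w =
      ∫ x in Omega L, (ν * gradNorm w x ^ 2 + κ * gradNorm w x ^ 3) := by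
    rw [dissipation, ← mul_assoc, mul_one_div_cancel (by positivity), one_mul]
  rw [← hdis]
  linarith

/-! ### Curves in a finite-dimensional space -/

section FiniteDimensional

variable {V : Type*} [AddCommGroup V] [Module ℝ V] [FiniteDimensional ℝ V]

/-- Regularity in time is known only through linear functionals. This expresses a bilinear form as a
finite sum of products of such functionals. -/
lemma bilin_eq_sum_coord (B : V →ₗ[ℝ] V →ₗ[ℝ] ℝ) (x y : V) :
    B x y = ∑ k, (Module.finBasis ℝ V).coord k x * B (Module.finBasis ℝ V k) y := by
  conv_lhs => rw [← (Module.finBasis ℝ V).sum_repr x]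
  simp only [map_sum, LinearMap.sum_apply, map_smul, LinearMap.smul_apply, smul_eq_mul,
    Module.Basis.coord_apply]

lemma continuousOn_bilin_self (B : V →ₗ[ℝ] V →ₗ[ℝ] ℝ) {f : ℝ → V} {s : Set ℝ}
    (hf : ∀ l : Module.Dual ℝ V, ContinuousOn (fun t => l (f t)) s) :
    ContinuousOn (fun t => B (f t) (f t)) s := by
  simp only [bilin_eq_sum_coord B (f _)]
  exact continuousOn_finsetSum _ fun k _ => (hf _).mul (hf (B _))

lemma hasDerivAt_bilin_self (B : V →ₗ[ℝ] V →ₗ[ℝ] ℝ) {f : ℝ → V} {f' : V} {t : ℝ}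
    (hf : ∀ l : Module.Dual ℝ V, HasDerivAt (fun t => l (f t)) (l f') t) :
    HasDerivAt (fun t => B (f t) (f t)) (B f' (f t) + B (f t) f') t := by
  rw [bilin_eq_sum_coord B f', bilin_eq_sum_coord B (f t), ← Finset.sum_add_distrib]
  simp only [bilin_eq_sum_coord B (f _)]
  exact HasDerivAt.fun_sum fun k _ => (hf _).fun_mul (hf (B _))

end FiniteDimensional

/-! ### The kinetic energy and the dissipation along a curve -/

lemma integrable_ip {L : ℝ} {u v : VField} (hu : MemSobolev L 3 u) (hv : MemSobolev L 3 v) :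
    Integrable (fun x => ∑ j, u.1 x j * v.1 x j) (volume.restrict (Omega L)) :=
  integrable_finsetSum _ fun j _ => integrable_mul_three (hu.val_memLp j) (hv.val_memLp j)

lemma ip_comm (L : ℝ) (u v : Pt → Pt) : ip L u v = ip L v u := by
  simp only [ip, mul_comm]

lemma ip_add_left {L : ℝ} {u v w : VField} (hu : MemSobolev L 3 u) (hv : MemSobolev L 3 v)
    (hw : MemSobolev L 3 w) : ip L (u + v).1 w.1 = ip L u.1 w.1 + ip L v.1 w.1 := by
  simp only [ip]
  rw [← integral_add (integrable_ip hu hw) (integrable_ip hv hw)]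
  simp [add_mul, Finset.sum_add_distrib]

lemma ip_smul_left (L c : ℝ) (u w : VField) : ip L (c • u).1 w.1 = c * ip L u.1 w.1 := by
  simp only [ip]
  rw [← integral_const_mul]
  simp [Finset.mul_sum, mul_assoc]

/-- The `L²` inner product as a bilinear form on a space of `W^{1,3}` fields. -/
noncomputable def ipForm {L : ℝ} {S : Submodule ℝ VField} (hS : ∀ v ∈ S, MemSobolev L 3 v) :
    S →ₗ[ℝ] S →ₗ[ℝ] ℝ :=
  LinearMap.mk₂ ℝ (fun u v => ip L (u : VField).1 (v : VField).1)
    (fun u v w => ip_add_left (hS u u.2) (hS v v.2) (hS w w.2))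
    (fun c u w => ip_smul_left L c u w)
    (fun w u v => by
      simp only [ip_comm L (w : VField).1]
      exact ip_add_left (hS u u.2) (hS v v.2) (hS w w.2))
    (fun c w u => by
      simp only [ip_comm L (w : VField).1]
      exact ip_smul_left L c u w)

lemma grad_sum_smul {S : Submodule ℝ VField} {n : ℕ} (e : Fin n → S) (c : Fin n → ℝ) (x : Pt)
    (i j : Fin 3) :
    ((∑ k, c k • e k : S) : VField).2 x i j = ∑ k, c k * (e k : VField).2 x i j := by
  simp [Prod.snd_sum, Finset.sum_apply]

lemma gradNorm_sum_smul_le {S : Submodule ℝ VField} {n : ℕ} (e : Fin n → S) {c : Fin n → ℝ}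
    {M : ℝ} (hc : ∀ k, |c k| ≤ M) (x : Pt) :
    gradNorm (∑ k, c k • e k : S) x ≤ 9 * ∑ k, M * gradNorm (e k) x := by
  refine (gradNorm_le_sum _ x).trans ?_
  have h : ∀ i j, |((∑ k, c k • e k : S) : VField).2 x i j| ≤ ∑ k, M * gradNorm (e k) x := by
    intro i j
    rw [grad_sum_smul]
    refine (Finset.abs_sum_le_sum_abs _ _).trans (Finset.sum_le_sum fun k _ => ?_)
    rw [abs_mul]
    exact mul_le_mul (hc k) (abs_grad_le_gradNorm _ x i j) (abs_nonneg _)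
      ((abs_nonneg _).trans (hc k))
  refine (Finset.sum_le_sum fun i _ => Finset.sum_le_sum fun j _ => h i j).trans (le_of_eq ?_)
  simp only [Finset.sum_const, Finset.card_univ, Fintype.card_fin]
  ring

/-- Dominated convergence: on the unit ball around `c₀` all gradients are bounded by one L³ function
built from the `e k`. -/
lemma continuous_dissipation {L ν : ℝ} (hν : 0 ≤ ν) (Cs δ : ℝ) {S : Submodule ℝ VField}
    (hS : ∀ v ∈ S, MemSobolev L 3 v) {n : ℕ} (e : Fin n → S) :
    Continuous fun c : Fin n → ℝ => dissipation L ν Cs δ (∑ k, c k • e k : S) := by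
  rw [continuous_iff_continuousAt]
  intro c₀
  unfold dissipation
  refine continuousAt_const.mul ?_
  set H : Pt → ℝ := fun x => 9 * ∑ k, (‖c₀‖ + 1) * gradNorm (e k) x with hH
  have hHL : MemLp H 3 (volume.restrict (Omega L)) :=
    (memLp_finsetSum _ fun k _ => (memLp_gradNorm (hS _ (e k).2)).const_mul _).const_mul _
  have hH0 : ∀ x, 0 ≤ H x := fun x => mul_nonneg (by norm_num)
    (Finset.sum_nonneg fun k _ => mul_nonneg (by positivity) (gradNorm_nonneg _ x))
  refine continuousAt_of_dominated (bound := fun x => ν * H x ^ 2 + (Cs * δ) ^ 2 * H x ^ 3)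
    ?_ ?_ ?_ ?_
  · exact Eventually.of_forall fun c =>
      (integrable_dissipation (hS _ (∑ k, c k • e k : S).2) ν ((Cs * δ) ^ 2)).aestronglyMeasurable
  · filter_upwards [Metric.ball_mem_nhds c₀ one_pos] with c hc
    refine Eventually.of_forall fun x => ?_
    have hcM : ∀ k, |c k| ≤ ‖c₀‖ + 1 := fun k => by
      have h1 : ‖c‖ ≤ ‖c₀‖ + ‖c - c₀‖ := norm_le_norm_add_norm_sub' c c₀
      have h2 : ‖c - c₀‖ < 1 := by rwa [← dist_eq_norm]
      have h3 := norm_le_pi_norm c k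
      rw [Real.norm_eq_abs] at h3
      linarith
    have hle := gradNorm_sum_smul_le e hcM x
    have h0 := gradNorm_nonneg (∑ k, c k • e k : S) x
    rw [Real.norm_of_nonneg (by positivity)]
    gcongr
  · refine Integrable.add (Integrable.const_mul ?_ _) (Integrable.const_mul ?_ _)
    · exact (memLp_two_of_three hHL).integrable_sq
    · simpa only [abs_of_nonneg (hH0 _)] using integrable_pow_three hHL
  · refine Eventually.of_forall fun x => Continuous.continuousAt ?_
    have hg : Continuous fun c : Fin n → ℝ => gradNorm (∑ k, c k • e k : S) x := by
      unfold gradNorm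
      simp only [grad_sum_smul]
      fun_prop
    fun_prop

lemma continuousOn_dissipation {L ν : ℝ} (hν : 0 ≤ ν) (Cs δ : ℝ) {S : Submodule ℝ VField}
    [FiniteDimensional ℝ S] (hS : ∀ v ∈ S, MemSobolev L 3 v) {u : ℝ → S} {s : Set ℝ}
    (hu : ∀ l : Module.Dual ℝ S, ContinuousOn (fun t => l (u t)) s) :
    ContinuousOn (fun t => dissipation L ν Cs δ (u t)) s := by
  have h := (continuous_dissipation hν Cs δ hS (Module.finBasis ℝ S)).comp_continuousOn
    (continuousOn_pi.2 fun k => hu ((Module.finBasis ℝ S).coord k))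
  refine h.congr fun t _ => ?_
  simp only [Function.comp, Module.Basis.coord_apply, (Module.finBasis ℝ S).sum_repr]

/-! ### The energy inequality -/

lemma divForm_sub_couette (L U : ℝ) (q : Pt → ℝ) (w : VField) :
    divForm L q (w - couette L U) = divForm L q w := by
  simp only [divForm, Fin.sum_univ_three, Prod.snd_sub, Pi.sub_apply, couette_grad]
  simp

lemma ip_self_nonneg (L : ℝ) (v : Pt → Pt) : 0 ≤ ip L v v :=
  integral_nonneg fun _ => Finset.sum_nonneg fun _ _ => mul_self_nonneg _

section Solution

variable {L U ν Cs δ : ℝ} {S : Submodule ℝ VField} {Q : Submodule ℝ (Pt → ℝ)} {u₀ : Pt → Pt}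
  {u ut : ℝ → S} {p : ℝ → Q}

/-- The momentum equation is tested with u − φ; the pressure term vanishes by discrete
incompressibility of u and div φ = 0. -/
lemma ip_time_derivative_le (hL : 0 < L) (hU : 0 < U) (hν : 0 < ν) (hCs : 0 < Cs) (hδ : 0 < δ)
    (hFE : IsFEPair L U S Q) (hu : IsSemiDiscreteSolution L U ν Cs δ S Q u₀ u ut p)
    {t : ℝ} (ht : 0 < t) :
    ip L (ut t : VField).1 ((u t : VField) - couette L U).1 ≤
      L ^ 3 * (dissipationBound L U ν ((Cs * δ) ^ 2) - 1 / 2 * dissipation L ν Cs δ (u t)) := by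
  have hX := hu.mem_X t ht.le
  have hvS : (u t : VField) - couette L U ∈ S :=
    S.sub_mem (u t).2 (hFE.contains_linears _ _ (memX_couette hL U))
  have hvX : MemX L 0 ((u t : VField) - couette L U) := by
    have := hX.sub (memX_couette hL U)
    rwa [sub_self] at this
  have hm := hu.momentum t ht _ hvS hvX
  rw [divForm_sub_couette, hu.continuity_eq t ht _ (p t).2] at hm
  have := energy_lower_bound hL hU hν hCs hδ (hFE.conforming _ (u t).2) hX
  linarith

lemma integral_dissipation_le (hL : 0 < L) (hU : 0 < U) (hν : 0 < ν) (hCs : 0 < Cs) (hδ : 0 < δ)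
    (hFE : IsFEPair L U S Q) (hu : IsSemiDiscreteSolution L U ν Cs δ S Q u₀ u ut p) :
    ∃ E₀ : ℝ, ∀ T : ℝ, 0 ≤ T → ∫ t in (0 : ℝ)..T, dissipation L ν Cs δ (u t) ≤
      E₀ + 2 * dissipationBound L U ν ((Cs * δ) ^ 2) * T := by
  have := hFE.finDim_velocity
  set K := dissipationBound L U ν ((Cs * δ) ^ 2)
  let φ : S := ⟨couette L U, hFE.contains_linears _ _ (memX_couette hL U)⟩
  set E : ℝ → ℝ := fun t => ipForm hFE.conforming (u t - φ) (u t - φ) with hE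
  have hEc : ContinuousOn E (Ici 0) := continuousOn_bilin_self _ fun l => by
    simp only [map_sub]
    exact (hu.continuous_time l).sub continuousOn_const
  have hEd : ∀ t, 0 < t → HasDerivAt E (2 * ip L (ut t : VField).1
      ((u t : VField) - couette L U).1) t := by
    intro t ht
    have h := hasDerivAt_bilin_self (ipForm hFE.conforming) (f := fun s => u s - φ)
      (f' := ut t) (t := t) fun l => by
        simp only [map_sub]
        exact (hu.hasDeriv_time l t ht).sub_const _
    refine h.congr_deriv ?_
    change ip L _ _ + ip L _ _ = _
    rw [ip_comm L ((u t - φ : S) : VField).1, two_mul]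
    rfl
  have hεc : ContinuousOn (fun t => dissipation L ν Cs δ (u t)) (Ici 0) :=
    continuousOn_dissipation hν.le Cs δ hFE.conforming hu.continuous_time
  -- Freezing the curve at time 0 for negative times makes the dissipation continuous on all of ℝ,
  -- so its primitive is differentiable everywhere.
  set ε : ℝ → ℝ := fun t => dissipation L ν Cs δ (u (max t 0)) with hε
  have hεcont : Continuous ε :=
    hεc.comp_continuous (f := fun t : ℝ => max t 0) (by fun_prop) fun t => le_max_right t 0
  -- The energy inequality in monotone form. Comparing times 0 and T and discarding `E T ≥ 0` gives
  -- the claim with `E₀ = E 0 / L ^ 3`.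
  have hanti : AntitoneOn (fun T => E T + L ^ 3 * ((∫ t in (0 : ℝ)..T, ε t) - 2 * K * T))
      (Ici 0) := by
    have hd : ∀ t, 0 < t → HasDerivAt
        (fun T => E T + L ^ 3 * ((∫ t in (0 : ℝ)..T, ε t) - 2 * K * T))
        (2 * ip L (ut t : VField).1 ((u t : VField) - couette L U).1 +
          L ^ 3 * (ε t - 2 * K * 1)) t := fun t ht =>
      (hEd t ht).add (((hεcont.integral_hasStrictDerivAt 0 t).hasDerivAt.sub
        ((hasDerivAt_id t).const_mul (2 * K))).const_mul (L ^ 3))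
    refine antitoneOn_of_deriv_nonpos (convex_Ici 0) ?_ ?_ ?_
    · refine hEc.add (Continuous.continuousOn ?_)
      exact continuous_const.mul ((intervalIntegral.continuous_primitive
        (fun a b => hεcont.intervalIntegrable a b) 0).sub (by fun_prop))
    · rw [interior_Ici]
      exact fun t ht => (hd t ht).differentiableAt.differentiableWithinAt
    · rw [interior_Ici]
      intro t ht
      rw [(hd t ht).deriv]
      have h := ip_time_derivative_le hL hU hν hCs hδ hFE hu ht
      have hmax : ε t = dissipation L ν Cs δ (u t) := by
        simp only [hε, max_eq_left (le_of_lt (mem_Ioi.1 ht))]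
      rw [hmax]
      linarith
  refine ⟨E 0 / L ^ 3, fun T hT => ?_⟩
  have h := hanti (mem_Ici.2 le_rfl) (mem_Ici.2 hT) hT
  simp only [intervalIntegral.integral_same, mul_zero, sub_zero, add_zero] at h
  have hET : 0 ≤ E T := ip_self_nonneg L _
  have heq : ∫ t in (0 : ℝ)..T, dissipation L ν Cs δ (u t) = ∫ t in (0 : ℝ)..T, ε t := by
    refine intervalIntegral.integral_congr fun t ht => ?_
    rw [uIcc_of_le hT] at ht
    simp only [hε, max_eq_left ht.1]
  rw [heq]
  have h3 : (∫ t in (0 : ℝ)..T, ε t) - 2 * K * T ≤ E 0 / L ^ 3 := by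
    rw [le_div_iff₀ (by positivity)]
    linarith
  linarith

/-! ### Time average and comparison with the stated bound -/

lemma timeAverage_le {ψ : ℝ → ℝ} {A B : ℝ}
    (h : ∀ T : ℝ, 0 ≤ T → ∫ t in (0 : ℝ)..T, ψ t ≤ A + B * T) : timeAverage ψ ≤ (B : EReal) := by
  have hlim : Tendsto (fun T : ℝ => ((A * T⁻¹ + B : ℝ) : EReal)) atTop (nhds (B : EReal)) := by
    rw [EReal.tendsto_coe]
    simpa using (tendsto_inv_atTop_zero.const_mul A).add_const B
  rw [← hlim.limsup_eq]
  refine limsup_le_limsup ?_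
  filter_upwards [eventually_gt_atTop 0] with T hT
  rw [EReal.coe_le_coe_iff]
  have := mul_le_mul_of_nonneg_left (h T hT.le) (by positivity : 0 ≤ 1 / T)
  refine this.trans (le_of_eq ?_)
  field_simp

/-- Each of the three terms is at most one of the first three target terms, which exceed it by a
power of L/h ≥ 1. The fourth target term is only needed to be nonnegative, and 16384 = 2 · 8192 is
the largest coefficient. -/
lemma dissipationBound_le {h : ℝ} (hL : 0 < L) (hU : 0 < U) (hν : 0 < ν) (hCs : 0 < Cs)
    (hδ : 0 < δ) (hh : 0 < h) (hhL : h < L) :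
    2 * dissipationBound L U ν ((Cs * δ) ^ 2) ≤
      16384 * (1 / reynolds U L ν * (L / h) + (Cs * δ / h) ^ 2 + L ^ 5 / ((Cs * δ) ^ 4 * h)
        + L ^ (5 / 2 : ℝ) / (Cs * δ) ^ 4 * h ^ (3 / 2 : ℝ)) * (U ^ 3 / L) := by
  set s := Cs * δ with hs
  have hs0 : 0 < s := mul_pos hCs hδ
  have hr : 1 ≤ L / h := (one_le_div hh).2 hhL.le
  have h1 : ν * (U / L) ^ 2 ≤ 1 / reynolds U L ν * (L / h) * (U ^ 3 / L) := by
    have e : 1 / reynolds U L ν * (L / h) * (U ^ 3 / L) = ν * (U / L) ^ 2 * (L / h) := by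
      unfold reynolds; field_simp
    rw [e]
    exact le_mul_of_one_le_right (by positivity) hr
  have h2 : s ^ 2 * (U / L) ^ 3 ≤ (s / h) ^ 2 * (U ^ 3 / L) := by
    have e : (s / h) ^ 2 * (U ^ 3 / L) = s ^ 2 * (U / L) ^ 3 * (L / h) ^ 2 := by field_simp
    rw [e]
    exact le_mul_of_one_le_right (by positivity) (one_le_pow₀ hr)
  have h3 : (U * L) ^ 3 / (s ^ 2) ^ 2 ≤ L ^ 5 / (s ^ 4 * h) * (U ^ 3 / L) := by
    have e : L ^ 5 / (s ^ 4 * h) * (U ^ 3 / L) = (U * L) ^ 3 / (s ^ 2) ^ 2 * (L / h) := by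
      field_simp
    rw [e]
    exact le_mul_of_one_le_right (by positivity) hr
  have h4 : 0 ≤ L ^ (5 / 2 : ℝ) / s ^ 4 * h ^ (3 / 2 : ℝ) * (U ^ 3 / L) := by positivity
  have h1' : 0 ≤ ν * (U / L) ^ 2 := by positivity
  have h2' : 0 ≤ s ^ 2 * (U / L) ^ 3 := by positivity
  unfold dissipationBound
  linarith

end Solution

end Smagorinsky

theorem theorem2 :
    ∃ C : ℝ, 0 < C ∧
      ∀ (L U ν Cs δ h : ℝ), 0 < L → 0 < U → 0 < ν → 0 < Cs → 0 < δ → 0 < h → h < L →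
      ∀ (S : Submodule ℝ Smagorinsky.VField) (Q : Submodule ℝ (Smagorinsky.Pt → ℝ)),
        Smagorinsky.IsFEPair L U S Q →
      ∀ u₀ : Smagorinsky.Pt → Smagorinsky.Pt,
        (∀ j, MemLp (fun x => u₀ x j) 2 (volume.restrict (Smagorinsky.Omega L))) →
      ∀ (u ut : ℝ → S) (p : ℝ → Q),
        Smagorinsky.IsSemiDiscreteSolution L U ν Cs δ S Q u₀ u ut p →
        (∀ T : ℝ, 0 < T → IntervalIntegrable
          (fun t => Smagorinsky.dissipation L ν Cs δ (u t)) volume 0 T) ∧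
        Smagorinsky.timeAverage (fun t => Smagorinsky.dissipation L ν Cs δ (u t)) ≤
          ((C * (1 / Smagorinsky.reynolds U L ν * (L / h) + (Cs * δ / h) ^ 2
              + L ^ 5 / ((Cs * δ) ^ 4 * h)
              + L ^ (5 / 2 : ℝ) / (Cs * δ) ^ 4 * h ^ (3 / 2 : ℝ)) * (U ^ 3 / L) : ℝ) : EReal) := by
  refine ⟨16384, by norm_num, ?_⟩
  intro L U ν Cs δ h hL hU hν hCs hδ hh hhL S Q hFE u₀ _ u ut p hu
  have := hFE.finDim_velocity
  refine ⟨fun T hT => ?_, ?_⟩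
  · refine ContinuousOn.intervalIntegrable ((Smagorinsky.continuousOn_dissipation hν.le Cs δ
      hFE.conforming hu.continuous_time).mono fun t ht => ?_)
    rw [uIcc_of_le hT.le] at ht
    exact ht.1
  · obtain ⟨E₀, hE⟩ := Smagorinsky.integral_dissipation_le hL hU hν hCs hδ hFE hu
    refine (Smagorinsky.timeAverage_le hE).trans ?_
    rw [EReal.coe_le_coe_iff]
    exact Smagorinsky.dissipationBound_le hL hU hν hCs hδ hh hhL
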